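/- Let $X=\{0,1\}^{\mathbb N}$, $\mathbb N=\{1,2,\dots\}$, let $T$ be the one-sided shift on $X$, let $\lambda(0)=\lambda(1)=\tfrac12$, and let $(P^{(n)})_{n\ge 1}$ be a sequence of bistochastic $2\times 2$ matrices with strictly positive entries such that all entries of $P^{(1)}$ equal $\tfrac12$. Let $\mu$ be the Markov measure on $X$ determined by $\mu([a_1,\dots,a_k])=\lambda(a_1)P^{(1)}_{a_1,a_2}\cdots P^{(k-1)}_{a_{k-1},a_k}$. Assume that $\mu$ is non-atomic and that $T$ is $\mu$-nonsingular, i.e. $\mu\circ T^{-1}\sim\mu$. A natural extension of $(X,\mu,T)$ is a standard Borel space $\widetilde X$ with a $\sigma$-finite measure $\widetilde\mu$, an invertible $\widetilde\mu$-nonsingular Borel transformation $\widetilde T$ of $\widetilde X$ and a Borel map $\pi:\widetilde X\to X$ such that $\widetilde\mu\circ\pi^{-1}=\mu$, $\pi\widetilde T=T\pi$ a.e., the Radon–Nikodym derivatives $\omega_{\widetilde T}=\frac{d\widetilde\mu\circ\widetilde T}{d\widetilde\mu}$ and $\omega_T=\frac{d\mu}{d\mu\circ T^{-1}}\circ T$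 satisfy $\omega_{\widetilde T}=\omega_T\circ\pi$ a.e., and the $\sigma$-algebras $\widetilde T^n\pi^{-1}(\mathfrak B_X)$, $n>0$, generate the Borel $\sigma$-algebra of $\widetilde X$ modulo $\widetilde\mu$-null sets. Suppose that $\mu$ is equivalent to a Bernoulli measure, i.e. to an infinite product $\bigotimes_{n\ge 1}\rho_n$ of probability measures on $\{0,1\}$. Then: 1. The two-sided shift on $\{0,1\}^{\mathbb Z}$, with restriction to the coordinates $n\ge1$ as the map $\pi$, is a natural extension of $(X,\mu,T)$ when it is equipped with the two-sided Markov measure given by $$[a_{-m},\dots,a_n]_{-m}^{n}\mapsto\Big(\prod_{-m< i\le 1}Q_{a_{i-1},a_i}\Big)\lambda(a_1)\prod_{1\le i<n}P^{(i)}_{a_i,a_{i+1}}\quad(m\ge -1,\ n\ge 1),\qquad Q_{i,j}=\frac{\lambda(i)P^{(1)}_{i,j}}{\lambda(0)P^{(1)}_{0,j}+\lambda(1)P^{(1)}_{1,j}}.$$ 2. Every natural extension $(\widetilde X,\widetilde\mu,\widetilde T)$ of $(X,\mu,T)$ is ergodic and of type $II_1$, i.e. $\widetilde\mu$ is non-atomic,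 $\widetilde T$ is ergodic, and there is a finite $\widetilde T$-invariant measure equivalent to $\widetilde\mu$. -/

import Mathlib

open MeasureTheory

universe u

namespace NonsingularMarkov

/-- Equivalence of measures: the same null sets. -/
def MeasEquiv {X : Type u} [MeasurableSpace X] (μ ν : Measure X) : Prop :=
  μ ≪ ν ∧ ν ≪ μ

/-! ### Nonsingular systems and their natural extensions -/

/-- `T` is a `μ`-nonsingular endomorphism: `T` is measurable and `μ ∘ T⁻¹ ∼ μ`. -/
structure IsNonsingular {X : Type u} [MeasurableSpace X] (T : X → X) (μ : Measure X) : Prop where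
  measurable : Measurable T
  equiv : MeasEquiv (μ.map T) μ

/-- The Radon-Nikodym derivative `ω_{T,μ} = (dμ / d(μ ∘ T⁻¹)) ∘ T` of an endomorphism. -/
noncomputable def endoDeriv {X : Type u} [MeasurableSpace X] (T : X → X) (μ : Measure X) :
    X → ENNReal :=
  fun x => μ.rnDeriv (μ.map T) (T x)

/-- The Radon-Nikodym derivative `ω_{S,ν} = d(ν ∘ S) / dν` of an invertible transformation, where
`(ν ∘ S) A = ν (S A)`, i.e. `ν ∘ S` is the image of `ν` under `S⁻¹`. -/
noncomputable def invDeriv {Y : Type u} [MeasurableSpace Y] (S : Y ≃ᵐ Y) (ν : Measure Y) :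
    Y → ENNReal :=
  (ν.map S.symm).rnDeriv ν

/-- `(Y, ν, S)`, with factor map `p`, is the natural extension of the nonsingular endomorphism
`(X, μ, T)`. -/
structure IsNaturalExtension {X : Type} {Y : Type u} [MeasurableSpace X] [MeasurableSpace Y]
    (T : X → X) (μ : Measure X) (S : Y ≃ᵐ Y) (ν : Measure Y) (p : Y → X) : Prop where
  standardBorel : StandardBorelSpace Y
  sigmaFinite : SigmaFinite ν
  nonsingular : IsNonsingular S ν
  measurable_factor : Measurable p
  map_factor : ν.map p = μ
  semiconj : ∀ᵐ y ∂ν, p (S y) = T (p y)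
  deriv_eq : ∀ᵐ y ∂ν, invDeriv S ν y = endoDeriv T μ (p y)
  /-- The join over `n > 0` of the `σ`-algebras `Sⁿ (p⁻¹ 𝔅)` is the whole `σ`-algebra of `Y`,
  modulo `ν`-null sets. -/
  generating : ∀ A : Set Y, MeasurableSet A →
    ∃ A' : Set Y,
      MeasurableSet[⨆ (n : ℕ) (_ : 0 < n),
        MeasurableSpace.comap (fun y => p (S.symm^[n] y)) inferInstance] A' ∧ A' =ᵐ[ν] A

/-- An invertible transformation `S` of a standard measure space is of type `II₁`: the measure `ν`
is non-atomic, `S` is nonsingular and ergodic, and there is a finite `S`-invariant measure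
equivalent to `ν`. -/
structure IsTypeIIOne {Y : Type u} [MeasurableSpace Y] (S : Y ≃ᵐ Y) (ν : Measure Y) : Prop where
  nonsingular : IsNonsingular S ν
  nonatomic : ∀ y, ν {y} = 0
  ergodic : QuasiErgodic S ν
  exists_invariant : ∃ κ : Measure Y,
    IsFiniteMeasure κ ∧ MeasurePreserving S κ κ ∧ MeasEquiv κ ν

/-! ### One-sided Markov measures

Coordinates are indexed from `0`: the initial distribution `lam` is the law of `x 0`, and the
matrix `P n` governs the transition from `x n` to `x (n + 1)`. -/

/-- `μ` is the (one-sided) Markov measure determined by `(lam, P)`. -/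
def IsMarkovMeasure (lam : Fin 2 → ℝ) (P : ℕ → Matrix (Fin 2) (Fin 2) ℝ)
    (μ : Measure (ℕ → Fin 2)) : Prop :=
  ∀ (n : ℕ) (a : ℕ → Fin 2), μ {x | ∀ i ≤ n, x i = a i} =
    ENNReal.ofReal (lam (a 0) * ∏ i ∈ Finset.range n, P i (a i) (a (i + 1)))

/-- Non-degeneracy of the pair `(lam, P)`. -/
def IsNondegenerate (lam : Fin 2 → ℝ) (P : ℕ → Matrix (Fin 2) (Fin 2) ℝ) : Prop :=
  (∀ a, 0 < lam a) ∧ ∀ n a b, 0 < P n a b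

/-- The one-sided shift. -/
def shift (x : ℕ → Fin 2) : ℕ → Fin 2 := fun n => x (n + 1)

/-- `(ℕ → Fin 2, μ, shift)` is the bistochastic nonsingular one-sided Markov shift determined by
`(lam, P)`. -/
structure IsBistochasticMarkovShift (lam : Fin 2 → ℝ) (P : ℕ → Matrix (Fin 2) (Fin 2) ℝ)
    (μ : Measure (ℕ → Fin 2)) : Prop where
  distribution : lam ∈ stdSimplex ℝ (Fin 2)
  bistochastic : ∀ n, P n ∈ doublyStochastic ℝ (Fin 2)
  markov : IsMarkovMeasure lam P μ
  nondegenerate : IsNondegenerate lam P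
  nonatomic : ∀ x, μ {x} = 0
  nonsingular : IsNonsingular shift μ

/-- Bernoulli measures: infinite products of probability measures on `{0, 1}`. -/
def IsBernoulliMeasure (β : Measure (ℕ → Fin 2)) : Prop :=
  ∃ ρ : ℕ → ProbabilityMeasure (Fin 2),
    β = Measure.infinitePi (fun n => (ρ n : Measure (Fin 2)))

/-! ### The two-sided Markov shift -/

/-- The two-sided shift. -/
def twoSidedShift : (ℤ → Fin 2) ≃ᵐ (ℤ → Fin 2) where
  toFun x := fun i => x (i + 1)
  invFun x := fun i => x (i - 1)
  left_inv x := by funext i; simp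
  right_inv x := by funext i; simp
  measurable_toFun := measurable_pi_lambda _ fun i => measurable_pi_apply (i + 1)
  measurable_invFun := measurable_pi_lambda _ fun i => measurable_pi_apply (i - 1)

/-- The restriction of a two-sided sequence to the coordinates `0, 1, 2, …`. -/
def restrictNat (x : ℤ → Fin 2) : ℕ → Fin 2 := fun n => x n

/-- The backward transition matrix
`Q i j = lam i * P₀ i j / (lam 0 * P₀ 0 j + lam 1 * P₀ 1 j)`. -/
noncomputable def backward (lam : Fin 2 → ℝ) (P₀ : Matrix (Fin 2) (Fin 2) ℝ) :
    Matrix (Fin 2) (Fin 2) ℝ :=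
  Matrix.of fun i j => lam i * P₀ i j / (lam 0 * P₀ 0 j + lam 1 * P₀ 1 j)

/-- `μ` is the two-sided Markov measure determined by `(lam, P)`: the coordinates `≥ 0` form the
one-sided Markov chain, and all the transitions between coordinates `≤ 0` are governed by the
backward matrix. -/
def IsTwoSidedMarkovMeasure (lam : Fin 2 → ℝ) (P : ℕ → Matrix (Fin 2) (Fin 2) ℝ)
    (μ : Measure (ℤ → Fin 2)) : Prop :=
  ∀ (m n : ℕ) (a : ℤ → Fin 2), μ {x | ∀ i : ℤ, -(m : ℤ) ≤ i → i ≤ n → x i = a i} =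
    ENNReal.ofReal
      ((∏ i ∈ Finset.range m, backward lam (P 0) (a (-(i : ℤ) - 1)) (a (-(i : ℤ)))) *
        lam (a 0) * ∏ i ∈ Finset.range n, P i (a i) (a ((i : ℤ) + 1)))

end NonsingularMarkov

/-! The theorem rests on two symmetries of `μ`. A bistochastic 2×2 matrix does not change when both
indices are exchanged and `lam` is uniform, so `μ` is invariant under exchanging 0 and 1 in all
coordinates. A product measure equivalent to `μ` is therefore absolutely continuous with respect to
its own exchange. By Kakutani's argument the affinities of the factors with their exchanges have
partial products bounded below. Since the affinity of `ρ` with the fair coin is at least its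
affinity with the exchange of `ρ`, the product measure, and hence `μ`, is equivalent to the fair
coin tossing measure `U` (`measEquiv_fairProduct`).

Because `P 0` is uniform, coordinate 0 is a fair coin independent of the others under `μ`. So `dμ/dU
= h ∘ shift`, where `h` is the density of `μ.map shift`. With `f = h ∘ shift`, the chain rule gives
`endoDeriv shift μ * f = f ∘ shift` almost everywhere: the Radon–Nikodym cocycle is a coboundary
(`exists_density`).

Lifting `f` to the two-sided fair coin shift gives the natural extension of the first claim.
Conversely, on any natural extension, dividing the measure by `f ∘ p` gives a finite invariant
measure lying over `U`. Its ergodicity follows from that of the one-sided shift, since the extension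
is generated by the factor (`preErgodic_of_generating`). -/

namespace NonsingularMarkov

open Filter Topology

set_option linter.unusedSectionVars false

/-! ### Hellinger affinity and absolute continuity of product measures -/

section Affinity

variable {α : Type*} [Fintype α] [MeasurableSpace α] [MeasurableSingletonClass α]

/-- The product of a sequence of probability measures. -/
noncomputable abbrev prodMeasure (ρ : ℕ → ProbabilityMeasure α) : Measure (ℕ → α) :=
  Measure.infinitePi (fun n => (ρ n : Measure α))

/-- The Hellinger affinity of two probability measures on a finite space. -/
noncomputable def affinity (ρ σ : ProbabilityMeasure α) : ℝ :=
  ∑ a, √((ρ : Measure α).real {a} * (σ : Measure α).real {a})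

lemma affinity_comm (ρ σ : ProbabilityMeasure α) : affinity ρ σ = affinity σ ρ := by
  simp only [affinity, mul_comm]

lemma affinity_nonneg (ρ σ : ProbabilityMeasure α) : 0 ≤ affinity ρ σ :=
  Finset.sum_nonneg fun _ _ => Real.sqrt_nonneg _

/-- The first `n` coordinates of a sequence. -/
def initial (n : ℕ) (x : ℕ → α) : Fin n → α := fun i => x i

lemma measurable_initial (n : ℕ) : Measurable (initial n : (ℕ → α) → Fin n → α) := by
  unfold initial; fun_prop

/-- The mass of a word under a product measure. -/
noncomputable def wordMass (ρ : ℕ → ProbabilityMeasure α) {n : ℕ} (w : Fin n → α) : ℝ :=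
  ∏ i : Fin n, (ρ i : Measure α).real {w i}

lemma wordMass_nonneg (ρ : ℕ → ProbabilityMeasure α) {n : ℕ} (w : Fin n → α) :
    0 ≤ wordMass ρ w :=
  Finset.prod_nonneg fun _ _ => measureReal_nonneg

lemma prodMeasure_word (ρ : ℕ → ProbabilityMeasure α) {n : ℕ} (w : Fin n → α) :
    (prodMeasure ρ).real (initial n ⁻¹' {w}) = wordMass ρ w := by
  classical
  rcases isEmpty_or_nonempty α with h | h
  · exact absurd (nonempty_of_isProbabilityMeasure (ρ 0 : Measure α)) (not_nonempty_iff.2 h)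
  let t : ℕ → Set α := fun i => if h : i < n then {w ⟨i, h⟩} else Set.univ
  have h1 : initial n ⁻¹' {w} = Set.pi (Finset.range n : Set ℕ) t := by
    ext x
    simp only [Set.mem_preimage, Set.mem_singleton_iff, funext_iff, initial, Set.mem_pi,
      Finset.coe_range, Set.mem_Iio, t]
    constructor
    · intro hx i hi
      simp only [hi, dif_pos, Set.mem_singleton_iff]
      exact hx ⟨i, hi⟩
    · intro hx i
      have := hx i i.2
      simpa using this
  rw [h1, measureReal_def, Measure.infinitePi_pi]
  · rw [ENNReal.toReal_prod, wordMass, Finset.prod_range]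
    refine Finset.prod_congr rfl fun i _ => ?_
    simp [t, measureReal_def]
  · intro i _
    simp only [t]
    split_ifs <;> simp

lemma prodMeasure_initial (ρ : ℕ → ProbabilityMeasure α) {n : ℕ} (s : Finset (Fin n → α)) :
    (prodMeasure ρ).real (initial n ⁻¹' s) = ∑ w ∈ s, wordMass ρ w := by
  rw [← map_measureReal_apply (measurable_initial n) s.measurableSet,
    ← sum_measureReal_singleton]
  refine Finset.sum_congr rfl fun w _ => ?_
  rw [map_measureReal_apply (measurable_initial n) (measurableSet_singleton w), prodMeasure_word]

lemma sum_wordMass (ρ : ℕ → ProbabilityMeasure α) (n : ℕ) :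
    ∑ w : Fin n → α, wordMass ρ w = 1 := by
  classical
  rw [← prodMeasure_initial]
  simp

lemma sum_sqrt_wordMass (ρ σ : ℕ → ProbabilityMeasure α) (n : ℕ) :
    ∑ w : Fin n → α, √(wordMass ρ w * wordMass σ w) =
      ∏ i ∈ Finset.range n, affinity (ρ i) (σ i) := by
  classical
  rw [Finset.prod_range]
  simp only [affinity, wordMass]
  rw [Finset.prod_univ_sum, Fintype.piFinset_univ]
  refine Finset.sum_congr rfl fun w _ => ?_
  rw [← Finset.prod_mul_distrib, Real.sqrt_prod]
  intro i _
  positivity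

/-- Absolute continuity of product measures bounds the affinities from below. -/
lemma exists_le_prod_affinity {ρ σ : ℕ → ProbabilityMeasure α}
    (h : prodMeasure ρ ≪ prodMeasure σ) :
    ∃ c > 0, ∀ n, c ≤ ∏ i ∈ Finset.range n, affinity (ρ i) (σ i) := by
  classical
  by_contra! hcon
  have hfin : ∫⁻ x, (prodMeasure ρ).rnDeriv (prodMeasure σ) x ∂(prodMeasure σ) ≠ ⊤ := by
    rw [Measure.lintegral_rnDeriv h]; simp
  -- Uniform absolute continuity: sets of small `σ`-mass have `ρ`-mass below 1/2.
  obtain ⟨δ, hδ, hs⟩ := exists_pos_setLIntegral_lt_of_measure_lt hfin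
    (ε := ENNReal.ofReal (1 / 2)) (by simp)
  obtain ⟨δ', hδ', hδδ⟩ : ∃ δ' : ℝ, 0 < δ' ∧ ENNReal.ofReal δ' ≤ δ := by
    rcases eq_or_ne δ ⊤ with rfl | hne
    · exact ⟨1, one_pos, le_top⟩
    · exact ⟨δ.toReal, ENNReal.toReal_pos hδ.ne' hne, by rw [ENNReal.ofReal_toReal hne]⟩
  obtain ⟨n, hn⟩ := hcon (min δ' (1 / 2)) (by positivity)
  -- The smaller of two masses is at most their geometric mean, so a small affinity makes this set
  -- `σ`-small and its complement `ρ`-small; together with `hs` the total `ρ`-mass falls below 1.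
  let s : Finset (Fin n → α) := Finset.univ.filter fun w => wordMass σ w < wordMass ρ w
  have hA : MeasurableSet (initial n ⁻¹' (s : Set (Fin n → α))) :=
    measurable_initial n s.measurableSet
  have h1 : (prodMeasure σ).real (initial n ⁻¹' s) < min δ' (1 / 2) := by
    refine lt_of_le_of_lt ?_ hn
    rw [prodMeasure_initial, ← sum_sqrt_wordMass]
    refine (Finset.sum_le_sum fun w hw => ?_).trans
      (Finset.sum_le_sum_of_subset_of_nonneg (Finset.subset_univ s)
        fun _ _ _ => Real.sqrt_nonneg _)
    have := (Finset.mem_filter.1 hw).2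
    exact Real.le_sqrt_of_sq_le (by nlinarith [wordMass_nonneg σ w])
  have h2 : (prodMeasure ρ).real (initial n ⁻¹' s)ᶜ < 1 / 2 := by
    refine lt_of_le_of_lt ?_ (hn.trans_le (min_le_right _ _))
    rw [← Set.preimage_compl, ← Finset.coe_compl, prodMeasure_initial, ← sum_sqrt_wordMass]
    refine (Finset.sum_le_sum fun w hw => ?_).trans
      (Finset.sum_le_sum_of_subset_of_nonneg (Finset.subset_univ sᶜ)
        fun _ _ _ => Real.sqrt_nonneg _)
    have : wordMass ρ w ≤ wordMass σ w := by simpa [s] using hw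
    exact Real.le_sqrt_of_sq_le (by nlinarith [wordMass_nonneg ρ w])
  have h3 : (prodMeasure ρ).real (initial n ⁻¹' s) < 1 / 2 := by
    have := hs (initial n ⁻¹' s) (lt_of_lt_of_le (by
      rw [← ofReal_measureReal]
      exact (ENNReal.ofReal_lt_ofReal_iff hδ').2 (h1.trans_le (min_le_left _ _))) hδδ)
    rw [Measure.setLIntegral_rnDeriv h] at this
    rw [← ofReal_measureReal] at this
    exact (ENNReal.ofReal_lt_ofReal_iff (by norm_num)).1 this
  have := measureReal_add_measureReal_compl (μ := prodMeasure ρ) hA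
  simp only [probReal_univ] at this
  linarith

/-- The sets depending on finitely many coordinates. -/
def initialSets (α : Type*) [Fintype α] : Set (Set (ℕ → α)) :=
  {A | ∃ (n : ℕ) (s : Set (Fin n → α)), A = initial n ⁻¹' s}

lemma initial_preimage_mono {n m : ℕ} (h : n ≤ m) (s : Set (Fin n → α)) :
    ∃ t : Set (Fin m → α), (initial n ⁻¹' s : Set (ℕ → α)) = initial m ⁻¹' t :=
  ⟨(fun w i => w (Fin.castLE h i)) ⁻¹' s, rfl⟩

lemma generateFrom_initialSets :
    (inferInstance : MeasurableSpace (ℕ → α)) = MeasurableSpace.generateFrom (initialSets α) := by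
  apply le_antisymm
  · refine iSup_le fun i => ?_
    rintro _ ⟨t, ht, rfl⟩
    refine MeasurableSpace.measurableSet_generateFrom
      ⟨i + 1, {w | w ⟨i, Nat.lt_succ_self i⟩ ∈ t}, rfl⟩
  · refine MeasurableSpace.generateFrom_le ?_
    rintro _ ⟨n, s, rfl⟩
    exact measurable_initial n s.toFinite.measurableSet

lemma isSetRing_initialSets : IsSetRing (initialSets α) where
  empty_mem := ⟨0, ∅, rfl⟩
  union_mem := by
    rintro _ _ ⟨n, s, rfl⟩ ⟨m, t, rfl⟩
    obtain ⟨s', hs⟩ := initial_preimage_mono (le_max_left n m) s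
    obtain ⟨t', ht⟩ := initial_preimage_mono (le_max_right n m) t
    exact ⟨_, s' ∪ t', by rw [hs, ht, Set.preimage_union]⟩
  sdiff_mem := by
    rintro _ _ ⟨n, s, rfl⟩ ⟨m, t, rfl⟩
    obtain ⟨s', hs⟩ := initial_preimage_mono (le_max_left n m) s
    obtain ⟨t', ht⟩ := initial_preimage_mono (le_max_right n m) t
    exact ⟨_, s' \ t', by rw [hs, ht, Set.preimage_sdiff]⟩

/-- Cauchy–Schwarz applied to `|p - q| = |√p - √q| (√p + √q)`: with `a` the affinity of the word
masses, the sums of squares are `2 - 2a` and `2 + 2a`, and their product `4(1 - a)(1 + a)` is at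
most `8ε`. -/
lemma abs_sub_initial_le {ρ σ : ℕ → ProbabilityMeasure α} {ε : ℝ}
    (h : ∀ n, 1 - ε ≤ ∏ i ∈ Finset.range n, affinity (ρ i) (σ i)) {A : Set (ℕ → α)}
    (hA : A ∈ initialSets α) :
    |(prodMeasure ρ).real A - (prodMeasure σ).real A| ≤ √(8 * ε) := by
  classical
  obtain ⟨n, s, rfl⟩ := hA
  obtain ⟨s, rfl⟩ := s.toFinite.exists_finset_coe
  rw [prodMeasure_initial, prodMeasure_initial, ← Finset.sum_sub_distrib]
  set p : (Fin n → α) → ℝ := fun w => wordMass ρ w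
  set q : (Fin n → α) → ℝ := fun w => wordMass σ w
  have hp : ∀ w, 0 ≤ p w := wordMass_nonneg ρ
  have hq : ∀ w, 0 ≤ q w := wordMass_nonneg σ
  have hp1 : ∑ w, p w = 1 := sum_wordMass ρ n
  have hq1 : ∑ w, q w = 1 := sum_wordMass σ n
  set a : ℝ := ∑ w, √(p w) * √(q w) with ha
  have haε : 1 - ε ≤ a := by
    refine (h n).trans_eq ?_
    rw [← sum_sqrt_wordMass, ha]
    exact Finset.sum_congr rfl fun w _ => Real.sqrt_mul (hp w) _
  have e1 : ∑ w, (√(p w) - √(q w)) ^ 2 = 2 - 2 * a := by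
    have : ∀ w, (√(p w) - √(q w)) ^ 2 = p w + q w - 2 * (√(p w) * √(q w)) := fun w => by
      rw [sub_sq, Real.sq_sqrt (hp w), Real.sq_sqrt (hq w)]; ring
    simp only [this, Finset.sum_sub_distrib, Finset.sum_add_distrib, hp1, hq1, ← Finset.mul_sum]
    ring
  have e2 : ∑ w, (√(p w) + √(q w)) ^ 2 = 2 + 2 * a := by
    have : ∀ w, (√(p w) + √(q w)) ^ 2 = p w + q w + 2 * (√(p w) * √(q w)) := fun w => by
      rw [add_sq, Real.sq_sqrt (hp w), Real.sq_sqrt (hq w)]; ring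
    simp only [this, Finset.sum_add_distrib, hp1, hq1, ← Finset.mul_sum]
    ring
  have ha1 : a ≤ 1 := by
    have : 0 ≤ ∑ w, (√(p w) - √(q w)) ^ 2 := Finset.sum_nonneg fun _ _ => sq_nonneg _
    linarith
  have key : |∑ w ∈ s, (p w - q w)| ≤ ∑ w, |√(p w) - √(q w)| * (√(p w) + √(q w)) := by
    refine (Finset.abs_sum_le_sum_abs _ _).trans ?_
    refine (Finset.sum_le_sum_of_subset_of_nonneg (Finset.subset_univ s)
      fun _ _ _ => abs_nonneg _).trans (Finset.sum_le_sum fun w _ => ?_)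
    rw [← abs_of_nonneg (show 0 ≤ √(p w) + √(q w) by positivity), ← abs_mul]
    refine le_of_eq ?_
    congr 1
    linear_combination Real.sq_sqrt (hq w) - Real.sq_sqrt (hp w)
  refine key.trans (Real.le_sqrt_of_sq_le ?_)
  refine (Finset.sum_mul_sq_le_sq_mul_sq _ _ _).trans ?_
  simp only [sq_abs]
  rw [e1, e2]
  have ha0 : 0 ≤ a := Finset.sum_nonneg fun _ _ => by positivity
  nlinarith

lemma abs_sub_prodMeasure_le {ρ σ : ℕ → ProbabilityMeasure α} {ε : ℝ}
    (h : ∀ n, 1 - ε ≤ ∏ i ∈ Finset.range n, affinity (ρ i) (σ i)) {A : Set (ℕ → α)}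
    (hA : MeasurableSet A) :
    |(prodMeasure ρ).real A - (prodMeasure σ).real A| ≤ √(8 * ε) := by
  refine le_of_forall_pos_le_add fun η hη => ?_
  -- Approximating in the sum of the two measures gives one set `t` that serves both.
  obtain ⟨t, ht, htA⟩ := exists_measure_symmDiff_lt_of_generateFrom_isSetRing
    (μ := prodMeasure ρ + prodMeasure σ) isSetRing_initialSets
    ⟨{Set.univ}, by simp, by
      rintro _ rfl; exact ⟨0, Set.univ, rfl⟩, by simp⟩
    generateFrom_initialSets hA (ε := ENNReal.ofReal (η / 2)) (by simpa using hη)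
  have htm : MeasurableSet t := by
    obtain ⟨n, s, rfl⟩ := ht
    exact measurable_initial n s.toFinite.measurableSet
  have aux : ∀ τ : ℕ → ProbabilityMeasure α,
      prodMeasure τ ≤ prodMeasure ρ + prodMeasure σ →
      |(prodMeasure τ).real t - (prodMeasure τ).real A| ≤ η / 2 := by
    intro τ hτ
    refine (abs_measureReal_sub_le_measureReal_symmDiff htm.nullMeasurableSet
      hA.nullMeasurableSet).trans ?_
    refine ENNReal.toReal_le_of_le_ofReal (by positivity) ((hτ _).trans htA.le)
  have h1 := aux ρ (Measure.le_add_right le_rfl)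
  have h2 := aux σ (Measure.le_add_left le_rfl)
  have h3 := abs_sub_initial_le h ht
  rw [abs_le] at *
  constructor <;> linarith [h1.1, h1.2, h2.1, h2.2, h3.1, h3.2]

/-- Disintegration of a product measure along one coordinate. -/
lemma prodMeasure_eq_sum_update (σ : ℕ → ProbabilityMeasure α) (j : ℕ) :
    prodMeasure σ = ∑ a, (σ j : Measure α) {a} •
      prodMeasure (Function.update σ j (diracProba a)) := by
  refine (Measure.eq_infinitePi _ fun s t ht => ?_).symm
  rw [Measure.finsetSum_apply]
  simp only [Measure.smul_apply, smul_eq_mul]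
  have hb : ∀ a, prodMeasure (Function.update σ j (diracProba a))
      (Set.pi s t) = (∏ i ∈ s.erase j, (σ i : Measure α) (t i)) *
        if j ∈ s then (t j).indicator 1 a else 1 := by
    intro a
    rw [prodMeasure, Measure.infinitePi_pi _ fun i _ => ht i]
    have hc : ∏ i ∈ s.erase j, ((Function.update σ j (diracProba a) i :
        ProbabilityMeasure α) : Measure α) (t i) = ∏ i ∈ s.erase j, (σ i : Measure α) (t i) :=
      Finset.prod_congr rfl fun i hi => by
        rw [Function.update_of_ne (Finset.ne_of_mem_erase hi)]
    split_ifs with hj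
    · rw [← Finset.prod_erase_mul _ _ hj, hc]
      rw [Function.update_self]
      exact congrArg _ (Measure.dirac_apply' _ (ht j))
    · rw [mul_one, ← hc, Finset.erase_eq_of_notMem hj]
  simp only [hb]
  have hsum : ∑ a, (σ j : Measure α) {a} * (if j ∈ s then (t j).indicator 1 a else 1) =
      if j ∈ s then (σ j : Measure α) (t j) else 1 := by
    classical
    split_ifs with hj
    · rw [← lintegral_indicator_one (ht j), lintegral_fintype]
      exact Finset.sum_congr rfl fun a _ => mul_comm _ _
    · simp [sum_measure_singleton]
  calc _ = (∏ i ∈ s.erase j, (σ i : Measure α) (t i)) *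
        ∑ a, (σ j : Measure α) {a} * (if j ∈ s then (t j).indicator 1 a else 1) := by
        rw [Finset.mul_sum]; exact Finset.sum_congr rfl fun a _ => by ring
    _ = _ := by
      rw [hsum]
      split_ifs with hj
      · exact Finset.prod_erase_mul _ _ hj
      · rw [mul_one, Finset.erase_eq_of_notMem hj]

/-- Coordinates are replaced one at a time. Disintegrated along coordinate `n`, the old and new
products have the same fibre measures and differ only in the weights, and the weights of `σ n` are
nonzero. -/
lemma prodMeasure_absolutelyContinuous_of_eventually {ρ σ : ℕ → ProbabilityMeasure α}
    (hσ : ∀ i a, (σ i : Measure α) {a} ≠ 0) :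
    ∀ n : ℕ, (∀ i, n ≤ i → ρ i = σ i) → prodMeasure ρ ≪ prodMeasure σ := by
  intro n
  induction n generalizing ρ with
  | zero =>
    intro h
    rw [funext fun i => h i (Nat.zero_le i)]
  | succ n ih =>
    intro h
    have h1 : prodMeasure (Function.update ρ n (σ n)) ≪ prodMeasure σ := by
      refine ih fun i hi => ?_
      rcases eq_or_ne i n with rfl | hne
      · simp
      · rw [Function.update_of_ne hne]
        exact h i (by omega)
    refine Measure.AbsolutelyContinuous.trans ?_ h1
    rw [prodMeasure_eq_sum_update ρ n, prodMeasure_eq_sum_update (Function.update ρ n (σ n)) n]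
    simp only [Function.update_idem, Function.update_self]
    intro A hA
    rw [Measure.finsetSum_apply] at hA ⊢
    simp only [Measure.smul_apply, smul_eq_mul, Finset.sum_eq_zero_iff, Finset.mem_univ,
      true_imp_iff, mul_eq_zero] at hA ⊢
    exact fun a => Or.inr ((hA a).resolve_left (hσ n a))

/-- A criterion for the absolute continuity of product measures. -/
lemma prodMeasure_absolutelyContinuous {ρ σ : ℕ → ProbabilityMeasure α}
    (hσ : ∀ i a, (σ i : Measure α) {a} ≠ 0)
    (h : ∀ ε > 0, ∃ n, ∀ m, 1 - ε ≤ ∏ i ∈ Finset.Ico n m, affinity (ρ i) (σ i)) :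
    prodMeasure ρ ≪ prodMeasure σ := by
  refine Measure.AbsolutelyContinuous.mk fun A hA h0 => ?_
  have key : ∀ ε : ℝ, 0 < ε → (prodMeasure ρ).real A ≤ √(8 * ε) := by
    intro ε hε
    obtain ⟨n, hn⟩ := h ε hε
    -- The hybrid `τ` is absolutely continuous with respect to `σ`, having finitely many altered
    -- factors, and close to `ρ`, since only the tail affinities enter.
    set τ : ℕ → ProbabilityMeasure α := fun i => if i < n then ρ i else σ i with hτ
    have h1 : prodMeasure τ A = 0 :=
      prodMeasure_absolutelyContinuous_of_eventually hσ n
        (fun i hi => by simp [hτ, Nat.not_lt.2 hi]) h0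
    have h2 := abs_sub_prodMeasure_le (ρ := ρ) (σ := τ) (ε := ε) (fun m => ?_) hA
    · rw [measureReal_def (prodMeasure τ), h1, ENNReal.toReal_zero, sub_zero] at h2
      exact (le_abs_self _).trans h2
    · refine (hn m).trans (le_of_eq ?_)
      symm
      have : ∀ i, affinity (ρ i) (τ i) = if i < n then 1 else affinity (ρ i) (σ i) := by
        intro i
        simp only [hτ]
        split_ifs
        · simp only [affinity, Real.sqrt_mul_self measureReal_nonneg]
          have := sum_measureReal_singleton (μ := (ρ i : Measure α)) Finset.univ
          simpa using this
        · rfl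
      simp only [this]
      rw [Finset.prod_ite, Finset.prod_const_one, one_mul]
      refine Finset.prod_congr ?_ fun _ _ => rfl
      ext i
      simp [and_comm]
  have : (prodMeasure ρ).real A ≤ 0 := by
    refine ge_of_tendsto (x := 𝓝[>] (0 : ℝ)) (f := fun ε => √(8 * ε)) ?_
      (eventually_nhdsWithin_of_forall key)
    have : Tendsto (fun ε : ℝ => √(8 * ε)) (𝓝 0) (𝓝 √(8 * 0)) :=
      Continuous.tendsto (by fun_prop) 0
    rw [mul_zero, Real.sqrt_zero] at this
    exact this.mono_left nhdsWithin_le_nhds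
  exact (measureReal_eq_zero_iff).1 (le_antisymm this measureReal_nonneg)

/-- Tails of a product of factors in `[0, 1]` which is bounded from below are close to `1`. -/
lemma exists_le_prod_Ico {s : ℕ → ℝ} (h0 : ∀ i, 0 ≤ s i) (h1 : ∀ i, s i ≤ 1) {c : ℝ} (hc : 0 < c)
    (h : ∀ n, c ≤ ∏ i ∈ Finset.range n, s i) {ε : ℝ} (hε : 0 < ε) :
    ∃ n, ∀ m, 1 - ε ≤ ∏ i ∈ Finset.Ico n m, s i := by
  have hanti : Antitone fun n => ∏ i ∈ Finset.range n, s i :=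
    antitone_nat_of_succ_le fun n => by
      rw [Finset.prod_range_succ]
      exact mul_le_of_le_one_right (Finset.prod_nonneg fun i _ => h0 i) (h1 n)
  set L := ⨅ n, ∏ i ∈ Finset.range n, s i
  have hbdd : BddBelow (Set.range fun n => ∏ i ∈ Finset.range n, s i) :=
    ⟨c, by rintro _ ⟨n, rfl⟩; exact h n⟩
  have hL : c ≤ L := le_ciInf h
  -- The initial product is at least `c`, so dividing by it turns the error `ε * c` into at most
  -- `ε`.
  obtain ⟨n, hn⟩ : ∃ n, ∏ i ∈ Finset.range n, s i < L + ε * c :=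
    exists_lt_of_ciInf_lt (lt_add_of_pos_right _ (by positivity))
  refine ⟨n, fun m => ?_⟩
  rcases le_total n m with hnm | hnm
  · have hm : L ≤ ∏ i ∈ Finset.range m, s i := ciInf_le hbdd m
    rw [← Finset.prod_range_mul_prod_Ico _ hnm] at hm
    have hcn := h n
    have hI : 0 ≤ ∏ i ∈ Finset.Ico n m, s i := Finset.prod_nonneg fun i _ => h0 i
    by_contra! hlt
    set a := ∏ i ∈ Finset.range n, s i
    nlinarith [mul_lt_mul_of_pos_left hlt (hc.trans_le hcn)]
  · rw [Finset.Ico_eq_empty_of_le hnm, Finset.prod_empty]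
    linarith

end Affinity

/-! ### Fair coin tossing and the exchange of symbols -/

/-- The fair coin. -/
noncomputable def fairCoin : ProbabilityMeasure (Fin 2) :=
  ⟨(2⁻¹ : ENNReal) • Measure.count, ⟨by
    simp [Measure.count_apply, ENNReal.inv_mul_cancel]⟩⟩

lemma fairCoin_singleton (a : Fin 2) : (fairCoin : Measure (Fin 2)) {a} = 2⁻¹ := by
  change ((2⁻¹ : ENNReal) • (Measure.count : Measure (Fin 2))) {a} = 2⁻¹
  simp

lemma fairCoin_map_equiv (e : Fin 2 ≃ Fin 2) :
    (fairCoin : Measure (Fin 2)).map e = fairCoin := by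
  refine Measure.ext_of_singleton fun a => ?_
  rw [Measure.map_apply (measurable_of_finite _) (measurableSet_singleton a)]
  have : e ⁻¹' {a} = {e.symm a} := by ext; simp [Equiv.eq_symm_apply]
  rw [this, fairCoin_singleton, fairCoin_singleton]

/-- The fair coin tossing measure. -/
noncomputable def fairProduct (ι : Type*) : Measure (ι → Fin 2) :=
  Measure.infinitePi fun _ => (fairCoin : Measure (Fin 2))

instance (ι : Type*) : IsProbabilityMeasure (fairProduct ι) := by
  unfold fairProduct; infer_instance

/-- Apply a permutation of the symbols in each coordinate. -/
def relabel {ι : Type*} (e : ι → (Fin 2 ≃ Fin 2)) (x : ι → Fin 2) : ι → Fin 2 :=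
  fun i => e i (x i)

lemma measurable_relabel {ι : Type*} (e : ι → (Fin 2 ≃ Fin 2)) : Measurable (relabel e) :=
  measurable_pi_lambda _ fun i => (measurable_of_finite (e i)).comp (measurable_pi_apply i)

lemma fairProduct_map_relabel {ι : Type*} (e : ι → (Fin 2 ≃ Fin 2)) :
    (fairProduct ι).map (relabel e) = fairProduct ι := by
  have := Measure.infinitePi_map_pi (fun _ : ι => (fairCoin : Measure (Fin 2)))
    (f := fun i => e i) fun i => measurable_of_finite (e i)
  simp only [fairCoin_map_equiv] at this
  exact this

/-- The image of a measure on symbols under the exchange of the two symbols. -/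
noncomputable def exchange (ρ : ProbabilityMeasure (Fin 2)) : ProbabilityMeasure (Fin 2) :=
  ρ.map (f := Fin.rev) (measurable_of_finite _).aemeasurable

lemma exchange_real (ρ : ProbabilityMeasure (Fin 2)) (a : Fin 2) :
    (exchange ρ : Measure (Fin 2)).real {a} = (ρ : Measure (Fin 2)).real {Fin.rev a} := by
  rw [exchange, ProbabilityMeasure.toMeasure_map, map_measureReal_apply (measurable_of_finite _)
    (measurableSet_singleton a)]
  congr 1
  ext b
  simp [Fin.rev_eq_iff]

lemma real_zero_add_real_one (ρ : ProbabilityMeasure (Fin 2)) :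
    (ρ : Measure (Fin 2)).real {0} + (ρ : Measure (Fin 2)).real {1} = 1 := by
  have := sum_measureReal_singleton (μ := (ρ : Measure (Fin 2))) Finset.univ
  simpa using this

lemma affinity_exchange (ρ : ProbabilityMeasure (Fin 2)) :
    affinity ρ (exchange ρ) =
      2 * (√((ρ : Measure (Fin 2)).real {0}) * √((ρ : Measure (Fin 2)).real {1})) := by
  simp only [affinity, exchange_real, Fin.sum_univ_two]
  rw [show Fin.rev (0 : Fin 2) = 1 from rfl, show Fin.rev (1 : Fin 2) = 0 from rfl,
    Real.sqrt_mul measureReal_nonneg, Real.sqrt_mul measureReal_nonneg]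
  ring

lemma affinity_exchange_le_one (ρ : ProbabilityMeasure (Fin 2)) :
    affinity ρ (exchange ρ) ≤ 1 := by
  rw [affinity_exchange]
  have h := real_zero_add_real_one ρ
  rw [← Real.sq_sqrt (measureReal_nonneg (μ := (ρ : Measure (Fin 2))) (s := {0})),
    ← Real.sq_sqrt (measureReal_nonneg (μ := (ρ : Measure (Fin 2))) (s := {1}))] at h
  nlinarith [sq_nonneg (√((ρ : Measure (Fin 2)).real {0}) - √((ρ : Measure (Fin 2)).real {1}))]

/-- If `s` is the left-hand side, the square of the right-hand side is `(1 + s) / 2`, and `s ^ 2 ≤ s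
≤ (1 + s) / 2` because `0 ≤ s ≤ 1`. -/
lemma affinity_exchange_le_affinity_fairCoin (ρ : ProbabilityMeasure (Fin 2)) :
    affinity ρ (exchange ρ) ≤ affinity ρ fairCoin := by
  have h1 := affinity_exchange_le_one ρ
  have h0 := affinity_nonneg ρ (exchange ρ)
  have h := real_zero_add_real_one ρ
  have hf : ∀ a, (fairCoin : Measure (Fin 2)).real {a} = 1 / 2 := fun a => by
    rw [measureReal_def, fairCoin_singleton]; simp
  have h2 : affinity ρ fairCoin ^ 2 = (1 + affinity ρ (exchange ρ)) / 2 := by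
    rw [affinity_exchange]
    simp only [affinity, hf, Fin.sum_univ_two, Real.sqrt_mul measureReal_nonneg]
    rw [← add_mul, mul_pow, Real.sq_sqrt (by norm_num), add_sq, Real.sq_sqrt measureReal_nonneg,
      Real.sq_sqrt measureReal_nonneg]
    linear_combination (1 / 2 : ℝ) * h
  refine (pow_le_pow_iff_left₀ h0 (affinity_nonneg _ _) two_ne_zero).1 ?_
  nlinarith

lemma ne_zero_of_affinity_exchange_pos {ρ : ProbabilityMeasure (Fin 2)}
    (h : 0 < affinity ρ (exchange ρ)) (a : Fin 2) : (ρ : Measure (Fin 2)) {a} ≠ 0 := by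
  intro h0
  rw [affinity_exchange] at h
  fin_cases a
  · simp [measureReal_def, show (ρ : Measure (Fin 2)) {0} = 0 from h0] at h
  · simp [measureReal_def, show (ρ : Measure (Fin 2)) {1} = 0 from h0] at h

/-- A measure which is invariant under the exchange of the two symbols and equivalent to a
Bernoulli measure is equivalent to the fair coin tossing measure. -/
theorem measEquiv_fairProduct {μ β : Measure (ℕ → Fin 2)} (hβ : IsBernoulliMeasure β)
    (hμβ : MeasEquiv μ β) (hμ : μ.map (relabel fun _ => Fin.revPerm) = μ) :
    MeasEquiv μ (fairProduct ℕ) := by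
  obtain ⟨ρ, rfl⟩ := hβ
  have hmap : (prodMeasure ρ).map (relabel fun _ => Fin.revPerm) =
      prodMeasure fun i => exchange (ρ i) :=
    Measure.infinitePi_map_pi (fun i => (ρ i : Measure (Fin 2)))
      (f := fun _ => Fin.rev) fun _ => measurable_of_finite _
  have hac : prodMeasure ρ ≪ prodMeasure fun i => exchange (ρ i) := by
    rw [← hmap]
    refine hμβ.2.trans ?_
    have := hμβ.1.map (measurable_relabel fun _ => Fin.revPerm)
    rwa [hμ] at this
  obtain ⟨c, hc, hcn⟩ := exists_le_prod_affinity hac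
  have htail : ∀ ε > 0, ∃ n, ∀ m, 1 - ε ≤ ∏ i ∈ Finset.Ico n m, affinity (ρ i) fairCoin := by
    intro ε hε
    obtain ⟨n, hn⟩ := exists_le_prod_Ico (fun i => affinity_nonneg (ρ i) (exchange (ρ i)))
      (fun i => affinity_exchange_le_one (ρ i)) hc hcn hε
    exact ⟨n, fun m => (hn m).trans (Finset.prod_le_prod (fun i _ => affinity_nonneg _ _)
      fun i _ => affinity_exchange_le_affinity_fairCoin (ρ i))⟩
  -- A symbol of mass zero would make one factor, hence a partial product, vanish.
  have hpos : ∀ i a, (ρ i : Measure (Fin 2)) {a} ≠ 0 := by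
    intro i
    refine ne_zero_of_affinity_exchange_pos ?_
    refine (affinity_nonneg _ _).lt_of_ne fun h => ?_
    have := hc.trans_le (hcn (i + 1))
    rw [Finset.prod_range_succ, ← h, mul_zero] at this
    exact lt_irrefl _ this
  have h1 : prodMeasure ρ ≪ fairProduct ℕ :=
    prodMeasure_absolutelyContinuous (σ := fun _ => fairCoin)
      (fun i a => by simp [fairCoin_singleton]) htail
  have h2 : fairProduct ℕ ≪ prodMeasure ρ :=
    prodMeasure_absolutelyContinuous (ρ := fun _ => fairCoin) hpos
      (by simpa only [affinity_comm fairCoin] using htail)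
  exact ⟨hμβ.1.trans h1, h2.trans hμβ.2⟩

/-! ### Markov measures and their symmetries -/

lemma map_withDensity_comp {X Y : Type*} [MeasurableSpace X] [MeasurableSpace Y] (m : Measure X)
    {g : X → Y} (hg : Measurable g) {h : Y → ENNReal} (hh : Measurable h) :
    (m.withDensity (h ∘ g)).map g = (m.map g).withDensity h := by
  ext s hs
  rw [Measure.map_apply hg hs, withDensity_apply _ (hg hs), withDensity_apply _ hs,
    setLIntegral_map hs hh hg]
  rfl

/-- Finite measures on one-sided sequences are determined by the cylinders. -/
lemma ext_of_cylinders {μ ν : Measure (ℕ → Fin 2)} [IsFiniteMeasure μ]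
    (h : ∀ (n : ℕ) (a : ℕ → Fin 2), μ {x | ∀ i ≤ n, x i = a i} = ν {x | ∀ i ≤ n, x i = a i}) :
    μ = ν := by
  classical
  have key : ∀ A ∈ initialSets (Fin 2), μ A = ν A := by
    rintro _ ⟨n, s, rfl⟩
    -- Cylinders fix the coordinates `0, …, n`, hence at least one; lengthening words to `n + 1`
    -- avoids the empty word. The default symbol 0 used below is never read.
    obtain ⟨t, ht⟩ := initial_preimage_mono (Nat.le_succ n) s
    rw [ht]
    obtain ⟨t, rfl⟩ := t.toFinite.exists_finset_coe
    rw [← Measure.map_apply (measurable_initial _) t.measurableSet,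
      ← Measure.map_apply (measurable_initial _) t.measurableSet,
      ← sum_measure_singleton, ← sum_measure_singleton]
    refine Finset.sum_congr rfl fun w _ => ?_
    rw [Measure.map_apply (measurable_initial _) (measurableSet_singleton w),
      Measure.map_apply (measurable_initial _) (measurableSet_singleton w)]
    have : (initial (n + 1) ⁻¹' {w} : Set (ℕ → Fin 2)) =
        {x | ∀ i ≤ n, x i = if hi : i < n + 1 then w ⟨i, hi⟩ else 0} := by
      ext x
      simp only [Set.mem_preimage, Set.mem_singleton_iff, funext_iff, initial, Set.mem_ofPred_eq]
      constructor
      · intro hx i hi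
        rw [dif_pos (Nat.lt_succ_of_le hi)]
        exact hx ⟨i, Nat.lt_succ_of_le hi⟩
      · intro hx i
        have := hx i (Nat.le_of_lt_succ i.2)
        simpa [i.2] using this
    rw [this]
    exact h n _
  exact ext_of_generate_finite _ generateFrom_initialSets
    isSetRing_initialSets.isSetSemiring.isPiSystem key (key _ ⟨0, Set.univ, rfl⟩)

lemma IsMarkovMeasure.isProbabilityMeasure {lam : Fin 2 → ℝ} {P : ℕ → Matrix (Fin 2) (Fin 2) ℝ}
    {μ : Measure (ℕ → Fin 2)} (h : IsMarkovMeasure lam P μ) (h0 : ∀ a, 0 ≤ lam a)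
    (h1 : ∑ a, lam a = 1) : IsProbabilityMeasure μ := by
  have e : ∀ a : Fin 2, μ {x | x 0 = a} = ENNReal.ofReal (lam a) := fun a => by
    simpa using h 0 fun _ => a
  refine ⟨?_⟩
  have hm : MeasurableSet {x : ℕ → Fin 2 | x 0 = 0} :=
    measurable_pi_apply 0 (measurableSet_singleton 0)
  have hc : {x : ℕ → Fin 2 | x 0 = 0}ᶜ = {x | x 0 = 1} := by
    ext x
    simp only [Set.mem_compl_iff, Set.mem_ofPred_eq]
    omega
  rw [← measure_add_measure_compl hm, hc, e, e, ← ENNReal.ofReal_add (h0 0) (h0 1)]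
  rw [Fin.sum_univ_two] at h1
  rw [h1, ENNReal.ofReal_one]

/-- Needed for two relabellings: the exchange in every coordinate and the exchange in coordinate 0
only. -/
lemma IsMarkovMeasure.map_relabel {lam : Fin 2 → ℝ} {P : ℕ → Matrix (Fin 2) (Fin 2) ℝ}
    {μ : Measure (ℕ → Fin 2)} [IsProbabilityMeasure μ] (h : IsMarkovMeasure lam P μ)
    (e : ℕ → (Fin 2 ≃ Fin 2)) (hlam : ∀ a, lam (e 0 a) = lam a)
    (hP : ∀ i a b, P i (e i a) (e (i + 1) b) = P i a b) : μ.map (relabel e) = μ := by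
  have : IsProbabilityMeasure (μ.map (relabel e)) :=
    Measure.isProbabilityMeasure_map (measurable_relabel e).aemeasurable
  refine ext_of_cylinders fun n a => ?_
  obtain ⟨b, rfl⟩ : ∃ b : ℕ → Fin 2, a = fun i => e i (b i) :=
    ⟨fun i => (e i).symm (a i), by simp⟩
  rw [Measure.map_apply (measurable_relabel e), h n]
  · simp only [Set.preimage_ofPred_eq, relabel, EmbeddingLike.apply_eq_iff_eq, h n, hlam, hP]
  · have : {x : ℕ → Fin 2 | ∀ i ≤ n, x i = e i (b i)} =
        ⋂ i ∈ Set.Iic n, (fun x => x i) ⁻¹' {e i (b i)} := by ext; simp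
    rw [this]
    exact MeasurableSet.biInter (Set.to_countable _) fun i _ =>
      measurable_pi_apply i (measurableSet_singleton _)

/-- The relabelling which exchanges the symbols in the coordinate `j` only. -/
def flipAt {ι : Type*} [DecidableEq ι] (j : ι) : (ι → Fin 2) → ι → Fin 2 :=
  relabel fun i => if i = j then Fin.revPerm else Equiv.refl _

lemma measurable_flipAt {ι : Type*} [DecidableEq ι] (j : ι) : Measurable (flipAt j) :=
  measurable_relabel _

lemma flipAt_self {ι : Type*} [DecidableEq ι] (j : ι) (x : ι → Fin 2) :
    flipAt j x j = Fin.rev (x j) := by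
  simp [flipAt, relabel]

lemma flipAt_of_ne {ι : Type*} [DecidableEq ι] {i j : ι} (h : i ≠ j) (x : ι → Fin 2) :
    flipAt j x i = x i := by
  simp [flipAt, relabel, h]

/-- The flip preserves `m` and swaps the two halves into which coordinate `j` cuts `B`. -/
lemma two_mul_measure_inter_coordinate {ι : Type*} [DecidableEq ι] {m : Measure (ι → Fin 2)}
    {j : ι} (hm : m.map (flipAt j) = m) {B : Set (ι → Fin 2)} (hB : MeasurableSet B)
    (hj : flipAt j ⁻¹' B = B) (a : Fin 2) : 2 * m (B ∩ {x | x j = a}) = m B := by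
  have hc : ∀ b : Fin 2, MeasurableSet {x : ι → Fin 2 | x j = b} := fun b =>
    measurableSet_eq_fun (measurable_pi_apply j) measurable_const
  have h1 : m (B ∩ {x | x j = Fin.rev a}) = m (B ∩ {x | x j = a}) := by
    conv_lhs => rw [← hm]
    rw [Measure.map_apply (measurable_flipAt j) (hB.inter (hc _)), Set.preimage_inter, hj]
    congr 2
    ext x
    simp [flipAt_self]
  rw [← measure_inter_add_sdiff B (hc a), two_mul]
  congr 1
  rw [← h1]
  congr 1
  ext x
  simp only [Set.mem_inter_iff, Set.mem_ofPred_eq, Set.mem_sdiff]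
  refine and_congr_right fun _ => ?_
  generalize x j = c
  clear h1
  revert a c
  decide

/-! ### The density of the Markov measure -/

lemma measurable_shift : Measurable shift :=
  measurable_pi_lambda _ fun i => measurable_pi_apply (i + 1)

lemma shift_flipAt_zero (x : ℕ → Fin 2) : shift (flipAt 0 x) = shift x :=
  funext fun i => flipAt_of_ne (Nat.succ_ne_zero i) x

/-- A measure whose initial coordinate is a fair coin independent of the other coordinates is
determined by its image under the shift. -/
lemma ext_of_map_shift {m m' : Measure (ℕ → Fin 2)} (hm : m.map (flipAt 0) = m)
    (hm' : m'.map (flipAt 0) = m') (h : m.map shift = m'.map shift) : m = m' := by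
  ext A hA
  have hc : MeasurableSet {x : ℕ → Fin 2 | x 0 = 0} :=
    measurable_pi_apply 0 (measurableSet_singleton 0)
  let cons : Fin 2 → (ℕ → Fin 2) → ℕ → Fin 2 := fun a y n => Nat.casesOn n a y
  have hcons : ∀ a, Measurable (cons a) := fun a => measurable_pi_lambda _ fun n => by
    cases n
    · exact measurable_const
    · exact measurable_pi_apply _
  -- Once the first symbol is fixed, membership in `A` depends on the shifted sequence alone.
  have hA' : ∀ a, A ∩ {x | x 0 = a} = shift ⁻¹' (cons a ⁻¹' A) ∩ {x | x 0 = a} := by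
    intro a
    ext x
    simp only [Set.mem_inter_iff, Set.mem_ofPred_eq, Set.mem_preimage]
    refine and_congr_left fun hx => ?_
    have : cons a (shift x) = x := by
      funext n
      cases n
      · exact hx.symm
      · rfl
    rw [this]
  have key : ∀ a, m (A ∩ {x | x 0 = a}) = m' (A ∩ {x | x 0 = a}) := by
    intro a
    have hB : MeasurableSet (cons a ⁻¹' A) := hcons a hA
    have hinv : flipAt 0 ⁻¹' (shift ⁻¹' (cons a ⁻¹' A)) = shift ⁻¹' (cons a ⁻¹' A) := by
      ext x
      simp only [Set.mem_preimage, shift_flipAt_zero]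
    rw [hA', ← ENNReal.mul_right_inj (a := 2) (by simp) (by simp),
      two_mul_measure_inter_coordinate hm (measurable_shift hB) hinv,
      two_mul_measure_inter_coordinate hm' (measurable_shift hB) hinv,
      ← Measure.map_apply measurable_shift hB, ← Measure.map_apply measurable_shift hB, h]
  rw [← measure_inter_add_sdiff A hc, ← measure_inter_add_sdiff (μ := m') A hc, key 0]
  congr 1
  have : A \ {x | x 0 = 0} = A ∩ {x | x 0 = 1} := by
    ext x
    simp only [Set.mem_sdiff, Set.mem_ofPred_eq, Set.mem_inter_iff]
    refine and_congr_right fun _ => ?_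
    omega
  rw [this]
  exact key 1

lemma fairProduct_map_reindex {ι κ : Type*} {g : ι → κ} (hg : Function.Injective g) :
    (fairProduct κ).map (fun x i => x (g i)) = fairProduct ι := by
  classical
  refine Measure.eq_infinitePi _ fun s t ht => ?_
  have hm : Measurable fun (x : κ → Fin 2) (i : ι) => x (g i) :=
    measurable_pi_lambda _ fun i => measurable_pi_apply (g i)
  rw [Measure.map_apply hm (MeasurableSet.pi s.countable_toSet fun i _ => ht i)]
  have hext : ∀ i, Function.extend g t (fun _ => Set.univ) (g i) = t i := fun i =>
    hg.extend_apply _ _ _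
  have : (fun (x : κ → Fin 2) (i : ι) => x (g i)) ⁻¹' Set.pi s t =
      Set.pi (s.image g : Finset κ) (Function.extend g t fun _ => Set.univ) := by
    ext x
    simp [Set.mem_pi, hext]
  rw [this, fairProduct, Measure.infinitePi_pi]
  · rw [Finset.prod_image hg.injOn]
    exact Finset.prod_congr rfl fun i _ => by rw [hext]
  · exact fun i _ => Set.toFinite _ |>.measurableSet

lemma measurePreserving_shift : MeasurePreserving shift (fairProduct ℕ) (fairProduct ℕ) :=
  ⟨measurable_shift, fairProduct_map_reindex (add_left_injective 1)⟩

/-- A Markov measure equivalent to the fair coin tossing measure whose first transition is uniform: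
the density depends on the shifted sequence only. -/
theorem exists_density {μ : Measure (ℕ → Fin 2)} [IsProbabilityMeasure μ]
    (hflip : μ.map (flipAt 0) = μ) (hns : IsNonsingular shift μ)
    (hμ : MeasEquiv μ (fairProduct ℕ)) :
    ∃ f : (ℕ → Fin 2) → ENNReal, Measurable f ∧ (∀ᵐ x ∂(fairProduct ℕ), f x ≠ 0 ∧ f x ≠ ⊤) ∧
      μ = (fairProduct ℕ).withDensity f ∧
      ∀ᵐ x ∂(fairProduct ℕ), endoDeriv shift μ x * f x = f (shift x) := by
  set U := fairProduct ℕ with hU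
  have : IsProbabilityMeasure U := hU ▸ inferInstance
  have : IsProbabilityMeasure (μ.map shift) :=
    Measure.isProbabilityMeasure_map measurable_shift.aemeasurable
  have : (μ.map shift).HaveLebesgueDecomposition U :=
    Measure.haveLebesgueDecomposition_of_sigmaFinite _ _
  set h := (μ.map shift).rnDeriv U with hh
  have hhm : Measurable h := Measure.measurable_rnDeriv _ _
  have hac : μ.map shift ≪ U := hns.equiv.1.trans hμ.1
  have hac' : U ≪ μ.map shift := hμ.2.trans hns.equiv.2
  have hh0 : ∀ᵐ x ∂U, h x ≠ 0 ∧ h x ≠ ⊤ := by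
    filter_upwards [hac'.ae_le (Measure.rnDeriv_pos hac), Measure.rnDeriv_ne_top (μ.map shift) U]
      with x h1 h2 using ⟨h1.ne', h2⟩
  -- Both sides are invariant under flipping coordinate 0, and both project to `h • U` under the
  -- shift.
  have hμf : μ = U.withDensity (h ∘ shift) := by
    refine ext_of_map_shift hflip ?_ ?_
    · have hc : (h ∘ shift) ∘ flipAt 0 = h ∘ shift :=
        funext fun x => congrArg h (shift_flipAt_zero x)
      conv_lhs => rw [← hc]
      rw [map_withDensity_comp _ (measurable_flipAt 0) (hhm.comp measurable_shift)]
      rw [show U.map (flipAt 0) = U from fairProduct_map_relabel _]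
    · rw [map_withDensity_comp _ measurable_shift hhm, measurePreserving_shift.map_eq,
        hh, Measure.withDensity_rnDeriv_eq _ _ hac]
  refine ⟨h ∘ shift, hhm.comp measurable_shift,
    measurePreserving_shift.quasiMeasurePreserving.ae hh0, hμf, ?_⟩
  -- Chain rule through `μ.map shift`: both sides are `dμ/dU`. Composing with the shift, which
  -- preserves `U`, gives the coboundary equation.
  have h1 : ∀ᵐ x ∂U, μ.rnDeriv (μ.map shift) x * h x = h (shift x) := by
    have h2 : μ.rnDeriv U =ᵐ[U] h ∘ shift := by
      conv_lhs => rw [hμf]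
      exact Measure.rnDeriv_withDensity _ (hhm.comp measurable_shift)
    filter_upwards [h2, Measure.rnDeriv_mul_rnDeriv (κ := U) hns.equiv.2] with x h3 h4
    rw [← Function.comp_apply (f := h), ← h3, ← h4]
    rfl
  exact measurePreserving_shift.quasiMeasurePreserving.ae h1

/-! ### Ergodicity of generated extensions and of the one-sided shift -/

section FactorErgodic

variable {X : Type} {Y : Type u} [MeasurableSpace X] [MeasurableSpace Y]

/-- Along a generating factor map, ergodicity passes from an endomorphism to its invertible
extension. -/
theorem preErgodic_of_generating {T : X → X} {U : Measure X} {S : Y ≃ᵐ Y} {κ : Measure Y}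
    [IsFiniteMeasure κ] {p : Y → X} (hT : QuasiErgodic T U) (hS : MeasurePreserving S κ κ)
    (hp : MeasurePreserving p κ U) (hsc : ∀ᵐ y ∂κ, p (S y) = T (p y))
    (hgen : ∀ A : Set Y, MeasurableSet A → ∃ A' : Set Y,
      MeasurableSet[⨆ (n : ℕ) (_ : 0 < n),
        MeasurableSpace.comap (fun y => p (S.symm^[n] y)) inferInstance] A' ∧ A' =ᵐ[κ] A) :
    PreErgodic S κ := by
  have hS' : MeasurePreserving S.symm κ κ := hS.symm S
  have hSn : ∀ n, MeasurePreserving (S.symm^[n]) κ κ := fun n => hS'.iterate n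
  set q : ℕ → Y → X := fun n y => p (S.symm^[n] y) with hq
  have hqm : ∀ n, Measurable (q n) := fun n => hp.measurable.comp (hSn n).measurable
  have hqT : ∀ n, ∀ᵐ y ∂κ, q n y = T (q (n + 1) y) := by
    intro n
    filter_upwards [(hSn (n + 1)).quasiMeasurePreserving.ae hsc] with y hy
    rw [hq]
    simp only
    rw [← hy, Function.iterate_succ_apply', S.apply_symm_apply]
  -- Since `q n = T ∘ q (n + 1)` almost everywhere, the σ-algebras pulled back by `q n` increase
  -- with `n` modulo null sets.
  have hmono : ∀ (n k : ℕ) (C : Set X), MeasurableSet C →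
      ∃ C', MeasurableSet C' ∧ q n ⁻¹' C =ᵐ[κ] q (n + k) ⁻¹' C' := by
    intro n k
    induction k with
    | zero => exact fun C hC => ⟨C, hC, EventuallyEq.rfl⟩
    | succ k ih =>
      intro C hC
      obtain ⟨C', hC', h⟩ := ih C hC
      refine ⟨T ⁻¹' C', hT.measurable hC', h.trans ?_⟩
      rw [eventuallyEq_set]
      filter_upwards [hqT (n + k)] with y hy
      simp only [Set.mem_preimage, hy]
      rfl
  have hmono' : ∀ {n m : ℕ}, n ≤ m → ∀ C : Set X, MeasurableSet C →
      ∃ C', MeasurableSet C' ∧ q n ⁻¹' C =ᵐ[κ] q m ⁻¹' C' := by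
    intro n m h C hC
    obtain ⟨k, rfl⟩ := Nat.exists_eq_add_of_le h
    exact hmono n k C hC
  -- Working up to null sets puts all measurable null sets into `R`, so that `R` generates the
  -- σ-algebra of `Y` exactly, not just modulo `κ`.
  let R : Set (Set Y) :=
    {E | MeasurableSet E ∧ ∃ (n : ℕ) (C : Set X), MeasurableSet C ∧ E =ᵐ[κ] q n ⁻¹' C}
  have hnull : ∀ E : Set Y, MeasurableSet E → κ E = 0 → E ∈ R := fun E hE h0 =>
    ⟨hE, 0, ∅, MeasurableSet.empty, by simpa using ae_eq_empty.2 h0⟩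
  have hR : IsSetRing R := by
    refine ⟨hnull ∅ .empty measure_empty, ?_, ?_⟩
    · rintro E F ⟨hE, n, C, hC, hEC⟩ ⟨hF, m, D, hD, hFD⟩
      obtain ⟨C', hC', h1⟩ := hmono' (le_max_left n m) C hC
      obtain ⟨D', hD', h2⟩ := hmono' (le_max_right n m) D hD
      exact ⟨hE.union hF, _, C' ∪ D', hC'.union hD', (hEC.trans h1).union (hFD.trans h2)⟩
    · rintro E F ⟨hE, n, C, hC, hEC⟩ ⟨hF, m, D, hD, hFD⟩
      obtain ⟨C', hC', h1⟩ := hmono' (le_max_left n m) C hC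
      obtain ⟨D', hD', h2⟩ := hmono' (le_max_right n m) D hD
      exact ⟨hE.diff hF, _, C' \ D', hC'.diff hD', (hEC.trans h1).diff (hFD.trans h2)⟩
  have hRgen : (inferInstance : MeasurableSpace Y) = MeasurableSpace.generateFrom R := by
    refine le_antisymm (fun A hA => ?_) (MeasurableSpace.generateFrom_le fun E hE => hE.1)
    obtain ⟨A', hA', hAA⟩ := hgen A hA
    have hle : (⨆ (n : ℕ) (_ : 0 < n),
        MeasurableSpace.comap (fun y => p (S.symm^[n] y)) inferInstance) ≤
        MeasurableSpace.generateFrom R := by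
      refine iSup₂_le fun n _ => ?_
      rintro _ ⟨C, hC, rfl⟩
      exact MeasurableSpace.measurableSet_generateFrom ⟨hqm n hC, n, C, hC, EventuallyEq.rfl⟩
    have hA'm : MeasurableSet A' :=
      MeasurableSpace.generateFrom_le (fun E (hE : E ∈ R) => hE.1) _ (hle _ hA')
    obtain ⟨h1, h2⟩ := ae_eq_set.1 hAA
    have e : A = (A' \ (A' \ A)) ∪ (A \ A') := by
      ext y; simp only [Set.mem_union, Set.mem_sdiff]; tauto
    rw [e]
    exact ((hle _ hA').diff (MeasurableSpace.measurableSet_generateFrom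
      (hnull _ (hA'm.diff hA) h1))).union
      (MeasurableSpace.measurableSet_generateFrom (hnull _ (hA.diff hA'm) h2))
  refine ⟨fun A hA hinv => ?_⟩
  have hinv' : ∀ n, S.symm^[n] ⁻¹' A = A := by
    have h1 : S.symm ⁻¹' A = A := by
      conv_lhs => rw [← hinv]
      ext y
      simp
    exact fun n => Function.IsFixedPt.preimage_iterate h1 n
  have happ : ∀ k : ℕ, ∃ C : Set X, MeasurableSet C ∧
      κ (symmDiff (p ⁻¹' C) A) ≤ (2⁻¹ : ENNReal) ^ k := by
    intro k
    obtain ⟨E, ⟨hE, n, C, hC, hEC⟩, hEA⟩ := exists_measure_symmDiff_lt_of_generateFrom_isSetRing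
      (μ := κ) hR ⟨{Set.univ}, by simp, by
        rintro _ rfl; exact ⟨.univ, 0, Set.univ, .univ, EventuallyEq.rfl⟩, by simp⟩
      hRgen hA (ε := (2⁻¹ : ENNReal) ^ k) (ENNReal.pow_pos (by simp) k)
    refine ⟨C, hC, ?_⟩
    -- Invariance of `A` and of `κ` moves the approximation from time `n` back to the factor itself
    -- with the same error.
    have h1 : κ (symmDiff (p ⁻¹' C) A) = κ (symmDiff (q n ⁻¹' C) A) := by
      rw [← (hSn n).measure_preimage ((hp.measurable hC).symmDiff hA).nullMeasurableSet,
        Set.preimage_symmDiff, hinv']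
      rfl
    rw [h1, ← measure_congr (hEC.symmDiff (EventuallyEq.refl _ A))]
    exact hEA.le
  choose C hC hCA using happ
  -- The errors are summable, so by Borel–Cantelli almost every `y` lies in `A` exactly when `p y`
  -- lies in `D`.
  set D := limsup C atTop with hD
  have hDm : MeasurableSet D := MeasurableSet.measurableSet_limsup hC
  have hAD : p ⁻¹' D =ᵐ[κ] A := by
    have hsum : ∑' k, κ (symmDiff (p ⁻¹' C k) A) ≠ ⊤ := by
      refine ne_top_of_le_ne_top ?_ (ENNReal.tsum_le_tsum hCA)
      rw [ENNReal.tsum_geometric]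
      simp
    rw [eventuallyEq_set]
    filter_upwards [ae_eventually_notMem hsum] with y hy
    have hy' : ∀ᶠ k in atTop, (p y ∈ C k ↔ y ∈ A) := by
      filter_upwards [hy] with k hk
      simp only [Set.mem_symmDiff, Set.mem_preimage] at hk
      tauto
    rw [Set.mem_preimage, hD, mem_limsup_iff_frequently_mem, frequently_congr hy']
    simp
  have hDinv : T ⁻¹' D =ᵐ[U] D := by
    have h1 : p ⁻¹' (T ⁻¹' D) =ᵐ[κ] p ⁻¹' D := by
      have h2 : S ⁻¹' (p ⁻¹' D) =ᵐ[κ] S ⁻¹' A := hS.quasiMeasurePreserving.preimage_ae_eq hAD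
      rw [hinv] at h2
      refine EventuallyEq.trans ?_ (h2.trans hAD.symm)
      rw [eventuallyEq_set]
      filter_upwards [hsc] with y hy
      simp only [Set.mem_preimage, hy]
    rw [← measure_symmDiff_eq_zero_iff] at h1 ⊢
    rw [← Set.preimage_symmDiff, hp.measure_preimage
      ((hT.measurable hDm).symmDiff hDm).nullMeasurableSet] at h1
    exact h1
  have hconst := hT.aeconst_set₀ hDm.nullMeasurableSet hDinv
  rw [← hp.aeconst_preimage hDm.nullMeasurableSet] at hconst
  exact hconst.congr hAD

end FactorErgodic

/-- The shift is ergodic for the fair coin tossing measure. -/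
theorem ergodic_shift : Ergodic shift (fairProduct ℕ) := by
  refine ⟨measurePreserving_shift, ⟨fun A hA hinv => ?_⟩⟩
  have hind : ProbabilityTheory.iIndepFun (fun i (x : ℕ → Fin 2) => x i) (fairProduct ℕ) :=
    ProbabilityTheory.iIndepFun_infinitePi (P := fun _ : ℕ => (fairCoin : Measure (Fin 2)))
      (X := fun _ => id) fun _ => measurable_id
  -- As `A = shift^[n] ⁻¹' A` for every `n`, the set `A` belongs to the tail σ-algebra, and
  -- Kolmogorov's zero–one law applies.
  have htail : MeasurableSet[limsup (fun i : ℕ =>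
      MeasurableSpace.comap (fun x : ℕ → Fin 2 => x i) inferInstance) atTop] A := by
    rw [limsup_eq_iInf_iSup_of_nat]
    simp only [MeasurableSpace.measurableSet_iInf]
    intro n
    have h1 : shift^[n] ⁻¹' A = A := Function.IsFixedPt.preimage_iterate hinv n
    have h2 : ∀ (n : ℕ) (x : ℕ → Fin 2) (i : ℕ), shift^[n] x i = x (i + n) := by
      intro n
      induction n with
      | zero => exact fun x i => rfl
      | succ n ih =>
        intro x i
        rw [Function.iterate_succ_apply, ih]
        exact congrArg x (by omega)
    have h3 : Measurable[⨆ i ≥ n, MeasurableSpace.comap (fun x : ℕ → Fin 2 => x i) inferInstance]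
        shift^[n] := by
      refine @measurable_pi_lambda _ _ _ (_) _ _ fun i => ?_
      simp only [h2]
      refine Measurable.mono (comap_measurable _) ?_ le_rfl
      exact le_iSup₂_of_le (i + n) (Nat.le_add_left n i) le_rfl
    rw [← h1]
    exact h3 hA
  have h01 := ProbabilityTheory.measure_zero_or_one_of_measurableSet_limsup_atTop
    (fun i => (measurable_pi_apply i).comap_le) hind.iIndep htail
  rw [eventuallyConst_set']
  rcases h01 with h | h
  · exact Or.inl (ae_eq_empty.2 h)
  · right
    rwa [ae_eq_univ, prob_compl_eq_zero_iff hA]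

/-! ### Natural extensions when the cocycle is a coboundary -/

section Density

variable {X : Type} {Y : Type u} [MeasurableSpace X] [MeasurableSpace Y]

lemma map_symm_withDensity (S : Y ≃ᵐ Y) (m : Measure Y) {g : Y → ENNReal} (hg : Measurable g) :
    (m.withDensity g).map S.symm = (m.map S.symm).withDensity (g ∘ S) := by
  have : g = (g ∘ S) ∘ S.symm := by ext y; simp
  conv_lhs => rw [this]
  exact map_withDensity_comp m S.symm.measurable (hg.comp S.measurable)

lemma isNonsingular_of_measurePreserving {S : Y → Y} {κ ν : Measure Y}
    (hS : MeasurePreserving S κ κ) (h : MeasEquiv κ ν) : IsNonsingular S ν where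
  measurable := hS.measurable
  equiv := by
    have h1 := h.1.map hS.measurable
    have h2 := h.2.map hS.measurable
    rw [hS.map_eq] at h1 h2
    exact ⟨h2.trans h.1, h.2.trans h1⟩

lemma measurable_endoDeriv {T : X → X} (hT : Measurable T) (μ : Measure X) :
    Measurable (endoDeriv T μ) :=
  (Measure.measurable_rnDeriv _ _).comp hT

lemma measEquiv_withDensity {κ : Measure Y} {g : Y → ENNReal} (hg : Measurable g)
    (h0 : ∀ᵐ y ∂κ, g y ≠ 0) : MeasEquiv κ (κ.withDensity g) :=
  ⟨withDensity_absolutelyContinuous' hg.aemeasurable h0, withDensity_absolutelyContinuous _ _⟩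

/-- An invertible measure preserving extension of `(X, U, T)` is a natural extension of
`(X, f • U, T)` when equipped with the lifted density. -/
theorem isNaturalExtension_withDensity [StandardBorelSpace Y] {T : X → X} {U μ : Measure X}
    [IsProbabilityMeasure μ] {f : X → ENNReal} (hT : Measurable T) (hf : Measurable f)
    (hf0 : ∀ᵐ x ∂U, f x ≠ 0) (hμ : μ = U.withDensity f)
    (hω : ∀ᵐ x ∂U, endoDeriv T μ x * f x = f (T x))
    {S : Y ≃ᵐ Y} {κ : Measure Y} {p : Y → X} (hS : MeasurePreserving S κ κ)
    (hp : MeasurePreserving p κ U) (hsc : ∀ y, p (S y) = T (p y))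
    (hgen : (⨆ (n : ℕ) (_ : 0 < n),
        MeasurableSpace.comap (fun y => p (S.symm^[n] y)) inferInstance) =
        (inferInstance : MeasurableSpace Y)) :
    IsNaturalExtension T μ S (κ.withDensity (f ∘ p)) p := by
  have hfp : Measurable (f ∘ p) := hf.comp hp.measurable
  have hequiv : MeasEquiv κ (κ.withDensity (f ∘ p)) :=
    measEquiv_withDensity hfp (hp.quasiMeasurePreserving.ae hf0)
  have hmap : (κ.withDensity (f ∘ p)).map p = μ := by
    rw [map_withDensity_comp _ hp.measurable hf, hp.map_eq, hμ]
  have hprob : IsProbabilityMeasure (κ.withDensity (f ∘ p)) := ⟨by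
    rw [← Set.preimage_univ (f := p), ← Measure.map_apply hp.measurable .univ, hmap,
      measure_univ]⟩
  refine ⟨inferInstance, inferInstance, isNonsingular_of_measurePreserving hS hequiv,
    hp.measurable, hmap, ae_of_all _ hsc, ?_, fun A hA => ⟨A, ?_, EventuallyEq.rfl⟩⟩
  · have hωm : Measurable (endoDeriv T μ ∘ p) := (measurable_endoDeriv hT μ).comp hp.measurable
    -- As `S` preserves `κ`, the image has `κ`-density `f ∘ p ∘ S = f ∘ T ∘ p`, which the coboundary
    -- equation factors as `(endoDeriv T μ ∘ p) * (f ∘ p)`.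
    have h1 : (κ.withDensity (f ∘ p)).map S.symm =
        (κ.withDensity (f ∘ p)).withDensity (endoDeriv T μ ∘ p) := by
      rw [map_symm_withDensity S κ hfp, (hS.symm S).map_eq, ← withDensity_mul _ hfp hωm]
      refine withDensity_congr_ae ?_
      filter_upwards [hp.quasiMeasurePreserving.ae hω] with y hy
      simp only [Function.comp_apply, Pi.mul_apply, hsc]
      rw [← hy, mul_comm]
    rw [invDeriv, h1]
    exact Measure.rnDeriv_withDensity _ hωm
  · rw [hgen]
    exact hA

/-- If the Radon-Nikodym cocycle of `(X, μ, T)` is a coboundary and `T` is ergodic, then every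
natural extension has type `II₁`. -/
theorem IsNaturalExtension.isTypeIIOne {T : X → X} {U μ : Measure X} [IsFiniteMeasure U]
    [IsProbabilityMeasure μ] {f : X → ENNReal} (hf : Measurable f)
    (hf0 : ∀ᵐ x ∂U, f x ≠ 0 ∧ f x ≠ ⊤) (hμ : μ = U.withDensity f)
    (hω : ∀ᵐ x ∂U, endoDeriv T μ x * f x = f (T x)) (hT : QuasiErgodic T U)
    (hatom : ∀ x, μ {x} = 0) {S : Y ≃ᵐ Y} {ν : Measure Y} {p : Y → X}
    (h : IsNaturalExtension T μ S ν p) : IsTypeIIOne S ν := by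
  have hpm := h.measurable_factor
  have hprob : IsProbabilityMeasure ν := ⟨by
    rw [← Set.preimage_univ (f := p), ← Measure.map_apply hpm .univ, h.map_factor,
      measure_univ]⟩
  have hpU : Measure.QuasiMeasurePreserving p ν U :=
    ⟨hpm, by rw [h.map_factor, hμ]; exact withDensity_absolutelyContinuous _ _⟩
  have hSq : Measure.QuasiMeasurePreserving S ν ν := ⟨S.measurable, h.nonsingular.equiv.1⟩
  have hSs : ν.map S.symm ≪ ν := by
    have := h.nonsingular.equiv.2.map S.symm.measurable
    rwa [Measure.map_map S.symm.measurable S.measurable, S.symm_comp_self, Measure.map_id]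
      at this
  set g : Y → ENNReal := fun y => (f (p y))⁻¹ with hg
  have hgm : Measurable g := (hf.comp hpm).inv
  have hf0' := hpU.ae hf0
  set κ := ν.withDensity g with hκ
  have hequiv : MeasEquiv κ ν := by
    have := measEquiv_withDensity (κ := ν) hgm (by
      filter_upwards [hf0'] with y hy using ENNReal.inv_ne_zero.2 hy.2)
    exact ⟨this.2, this.1⟩
  have hκp : κ.map p = U := by
    rw [hκ, show g = f⁻¹ ∘ p from rfl, map_withDensity_comp _ hpm hf.inv,
      h.map_factor, hμ, ← withDensity_mul _ hf hf.inv]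
    conv_rhs => rw [← withDensity_one (μ := U)]
    refine withDensity_congr_ae ?_
    filter_upwards [hf0] with x hx
    exact ENNReal.mul_inv_cancel hx.1 hx.2
  have hκfin : IsFiniteMeasure κ := ⟨by
    rw [← Set.preimage_univ (f := p), ← Measure.map_apply hpm .univ, hκp]
    exact measure_lt_top _ _⟩
  -- Invariance is checked for `S.symm`, whose image of `ν` has density `invDeriv S ν`. The identity
  -- needed is `ω(p y) / f(T(p y)) = 1 / f(p y)`, with `ω = endoDeriv T μ`.
  have hinv : MeasurePreserving S κ κ := by
    refine MeasurePreserving.symm S.symm ⟨S.symm.measurable, ?_⟩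
    have h1 : ν.map S.symm = ν.withDensity (invDeriv S ν) :=
      (Measure.withDensity_rnDeriv_eq _ _ hSs).symm
    rw [hκ, map_symm_withDensity S ν hgm, h1,
      ← withDensity_mul _ (show Measurable (invDeriv S ν) from Measure.measurable_rnDeriv _ _)
        (hgm.comp S.measurable)]
    refine withDensity_congr_ae ?_
    filter_upwards [h.deriv_eq, h.semiconj, hpU.ae hω, hf0', hSq.ae hf0'] with y h2 h3 h4 h5 h6
    simp only [Pi.mul_apply, Function.comp_apply, hg]
    rw [h3, ← h4] at h6 ⊢
    rw [h2]
    calc _ = endoDeriv T μ (p y) * (f (p y) * (f (p y))⁻¹) *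
          (endoDeriv T μ (p y) * f (p y))⁻¹ := by
          rw [ENNReal.mul_inv_cancel h5.1 h5.2, mul_one]
      _ = (f (p y))⁻¹ * ((endoDeriv T μ (p y) * f (p y)) *
          (endoDeriv T μ (p y) * f (p y))⁻¹) := by ring
      _ = _ := by rw [ENNReal.mul_inv_cancel h6.1 h6.2, mul_one]
  have hκν : ∀ {P : Y → Prop}, (∀ᵐ y ∂ν, P y) → ∀ᵐ y ∂κ, P y := fun hP => hequiv.1.ae_le hP
  have hpre : PreErgodic S κ :=
    preErgodic_of_generating hT hinv ⟨hpm, hκp⟩ (hκν h.semiconj) fun A hA => by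
      obtain ⟨A', hA', hAA⟩ := h.generating A hA
      exact ⟨A', hA', hequiv.1.ae_le hAA⟩
  refine ⟨h.nonsingular, fun y => ?_, ⟨hSq, ⟨fun A hA hAS => ?_⟩⟩, κ, hκfin, hinv, hequiv⟩
  -- A point lies in its fibre, whose mass is that of the point `p y`, namely zero.
  · refine measure_mono_null (t := p ⁻¹' {p y}) (by simp) ?_
    by_contra hne
    have := Measure.le_map_apply hpm.aemeasurable {p y} (μ := ν)
    rw [h.map_factor, hatom] at this
    exact hne (le_antisymm this (zero_le))
  · exact (hpre.aeconst_set hA hAS).anti hequiv.2.ae_le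

end Density

/-! ### The two-sided shift -/

lemma measurePreserving_restrictNat :
    MeasurePreserving restrictNat (fairProduct ℤ) (fairProduct ℕ) :=
  ⟨measurable_pi_lambda _ fun i => measurable_pi_apply (i : ℤ),
    fairProduct_map_reindex Nat.cast_injective⟩

lemma measurePreserving_twoSidedShift :
    MeasurePreserving twoSidedShift (fairProduct ℤ) (fairProduct ℤ) :=
  ⟨twoSidedShift.measurable, fairProduct_map_reindex (add_left_injective 1)⟩

lemma iterate_twoSidedShift_symm (n : ℕ) (x : ℤ → Fin 2) (i : ℤ) :
    (twoSidedShift.symm^[n] x) i = x (i - n) := by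
  induction n generalizing x with
  | zero => simp
  | succ n ih =>
    rw [Function.iterate_succ_apply, ih]
    change x (i - n - 1) = _
    congr 1
    push_cast
    ring

lemma iSup_comap_restrictNat :
    (⨆ (n : ℕ) (_ : 0 < n), MeasurableSpace.comap
      (fun y : ℤ → Fin 2 => restrictNat (twoSidedShift.symm^[n] y)) inferInstance) =
      (inferInstance : MeasurableSpace (ℤ → Fin 2)) := by
  refine le_antisymm (iSup₂_le fun n _ => Measurable.comap_le ?_) (iSup_le fun i => ?_)
  · exact measurePreserving_restrictNat.measurable.comp
      (twoSidedShift.symm.measurable.iterate n)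
  -- After `n` backward shifts coordinate `i` sits at `i + n`; the choice `n = |i| + 1` makes this
  -- nonnegative and `n` positive.
  · refine le_iSup₂_of_le (i.natAbs + 1) (Nat.succ_pos _) ?_
    rintro _ ⟨t, ht, rfl⟩
    refine ⟨(fun x => x (i + (i.natAbs + 1 : ℕ)).toNat) ⁻¹' t, measurable_pi_apply _ ht, ?_⟩
    ext x
    simp only [Set.mem_preimage, restrictNat, iterate_twoSidedShift_symm]
    rw [Int.toNat_of_nonneg (by omega), add_sub_cancel_right]

/-- The lifted density ignores negative coordinates, so each of them is a fair coin independent of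
the rest; this matches the backward matrix, all of whose entries are 1/2 here. -/
lemma isTwoSidedMarkovMeasure_withDensity {lam : Fin 2 → ℝ}
    {P : ℕ → Matrix (Fin 2) (Fin 2) ℝ} {μ : Measure (ℕ → Fin 2)} (hμ : IsMarkovMeasure lam P μ)
    (hlam : ∀ a, lam a = 1 / 2) (hP : ∀ a b, P 0 a b = 1 / 2) {f : (ℕ → Fin 2) → ENNReal}
    (hf : Measurable f) (hμf : μ = (fairProduct ℕ).withDensity f) :
    IsTwoSidedMarkovMeasure lam P ((fairProduct ℤ).withDensity (f ∘ restrictNat)) := by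
  have hr := measurePreserving_restrictNat
  set ν := (fairProduct ℤ).withDensity (f ∘ restrictNat) with hν
  have hmap : ν.map restrictNat = μ := by
    rw [hν, map_withDensity_comp _ hr.measurable hf, hr.map_eq, hμf]
  have hb : ∀ a b, backward lam (P 0) a b = 1 / 2 := fun a b => by
    simp only [backward, Matrix.of_apply, hlam, hP]; norm_num
  have hcyl : ∀ (m n : ℕ) (a : ℤ → Fin 2),
      MeasurableSet {x : ℤ → Fin 2 | ∀ i : ℤ, -(m : ℤ) ≤ i → i ≤ n → x i = a i} := by
    intro m n a
    simp only [Set.ofPred_forall]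
    exact MeasurableSet.iInter fun i => MeasurableSet.iInter fun _ => MeasurableSet.iInter
      fun _ => measurableSet_eq_fun (measurable_pi_apply i) measurable_const
  intro m n a
  induction m with
  | zero =>
    have h1 : {x : ℤ → Fin 2 | ∀ i : ℤ, -((0 : ℕ) : ℤ) ≤ i → i ≤ n → x i = a i} =
        restrictNat ⁻¹' {x | ∀ i ≤ n, x i = a i} := by
      ext x
      simp only [Set.mem_ofPred_eq, Set.mem_preimage, restrictNat]
      constructor
      · exact fun h i hi => h i (by omega) (by omega)
      · intro h i h0 hi
        have := h i.toNat (by omega)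
        rwa [Int.toNat_of_nonneg (by omega)] at this
    have h2 : MeasurableSet {x : ℕ → Fin 2 | ∀ i ≤ n, x i = a i} := by
      simp only [Set.ofPred_forall]
      exact MeasurableSet.iInter fun i => MeasurableSet.iInter fun _ =>
        measurableSet_eq_fun (measurable_pi_apply i) measurable_const
    rw [h1, ← Measure.map_apply hr.measurable h2, hmap, hμ n fun i => a i]
    simp
  | succ m ih =>
    have hj : ν.map (flipAt (-((m : ℤ) + 1))) = ν := by
      have hc : (f ∘ restrictNat) ∘ flipAt (-((m : ℤ) + 1)) = f ∘ restrictNat := by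
        funext x
        refine congrArg f (funext fun i => flipAt_of_ne ?_ x)
        omega
      rw [hν]
      conv_lhs => rw [← hc]
      rw [map_withDensity_comp _ (measurable_flipAt _) (hf.comp hr.measurable)]
      rw [show (fairProduct ℤ).map (flipAt _) = fairProduct ℤ from fairProduct_map_relabel _]
    have hinv : flipAt (-((m : ℤ) + 1)) ⁻¹'
        {x : ℤ → Fin 2 | ∀ i : ℤ, -(m : ℤ) ≤ i → i ≤ n → x i = a i} =
        {x : ℤ → Fin 2 | ∀ i : ℤ, -(m : ℤ) ≤ i → i ≤ n → x i = a i} := by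
      ext x
      simp only [Set.mem_preimage, Set.mem_ofPred_eq]
      refine forall_congr' fun i => forall_congr' fun hi => ?_
      rw [flipAt_of_ne (by omega)]
    have hsplit : {x : ℤ → Fin 2 | ∀ i : ℤ, -((m + 1 : ℕ) : ℤ) ≤ i → i ≤ n → x i = a i} =
        {x : ℤ → Fin 2 | ∀ i : ℤ, -(m : ℤ) ≤ i → i ≤ n → x i = a i} ∩
          {x | x (-((m : ℤ) + 1)) = a (-((m : ℤ) + 1))} := by
      ext x
      simp only [Set.mem_ofPred_eq, Set.mem_inter_iff]
      constructor
      · exact fun h => ⟨fun i h1 h2 => h i (by omega) h2, h _ (by omega) (by omega)⟩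
      · rintro ⟨h1, h2⟩ i h3 h4
        rcases eq_or_ne i (-((m : ℤ) + 1)) with rfl | hne
        · exact h2
        · exact h1 i (by omega) h4
    rw [← ENNReal.mul_right_inj (a := 2) (by simp) (by simp), hsplit,
      two_mul_measure_inter_coordinate hj (hcyl m n a) hinv, ih, Finset.prod_range_succ, hb,
      show (2 : ENNReal) = ENNReal.ofReal 2 by simp, ← ENNReal.ofReal_mul (by norm_num)]
    congr 1
    ring

/-! ### Bistochastic Markov shifts -/

lemma IsBistochasticMarkovShift.isProbabilityMeasure {lam : Fin 2 → ℝ}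
    {P : ℕ → Matrix (Fin 2) (Fin 2) ℝ} {μ : Measure (ℕ → Fin 2)}
    (h : IsBistochasticMarkovShift lam P μ) : IsProbabilityMeasure μ :=
  h.markov.isProbabilityMeasure h.distribution.1 h.distribution.2

lemma rev_apply_rev_of_mem_doublyStochastic {M : Matrix (Fin 2) (Fin 2) ℝ}
    (hM : M ∈ doublyStochastic ℝ (Fin 2)) (a b : Fin 2) : M (Fin.rev a) (Fin.rev b) = M a b := by
  have h1 := fun i => sum_row_of_mem_doublyStochastic hM i
  have h2 := fun j => sum_col_of_mem_doublyStochastic hM j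
  simp only [Fin.sum_univ_two] at h1 h2
  have := h1 0
  have := h1 1
  have := h2 0
  have := h2 1
  fin_cases a <;> fin_cases b <;> simp [Fin.rev] <;> linarith

end NonsingularMarkov

theorem proposition8p2 (lam : Fin 2 → ℝ) (P : ℕ → Matrix (Fin 2) (Fin 2) ℝ)
    (μ : Measure (ℕ → Fin 2))
    (hμ : NonsingularMarkov.IsBistochasticMarkovShift lam P μ)
    (hlam : ∀ a, lam a = 1 / 2) (hP : ∀ a b, P 0 a b = 1 / 2)
    (hB : ∃ β : Measure (ℕ → Fin 2),
      NonsingularMarkov.IsBernoulliMeasure β ∧ NonsingularMarkov.MeasEquiv μ β) :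
    (∃ μ' : Measure (ℤ → Fin 2),
      NonsingularMarkov.IsTwoSidedMarkovMeasure lam P μ' ∧
      NonsingularMarkov.IsNaturalExtension NonsingularMarkov.shift μ
        NonsingularMarkov.twoSidedShift μ' NonsingularMarkov.restrictNat) ∧
    ∀ (Y : Type u) [MeasurableSpace Y] (S : Y ≃ᵐ Y) (ν : Measure Y) (p : Y → (ℕ → Fin 2)),
      NonsingularMarkov.IsNaturalExtension NonsingularMarkov.shift μ S ν p →
      QuasiErgodic S ν ∧ NonsingularMarkov.IsTypeIIOne S ν := by
  open NonsingularMarkov in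
  have hprob : IsProbabilityMeasure μ := hμ.isProbabilityMeasure
  obtain ⟨β, hβ, hμβ⟩ := hB
  have hequiv : MeasEquiv μ (fairProduct ℕ) :=
    measEquiv_fairProduct hβ hμβ (hμ.markov.map_relabel _ (by simp [hlam])
      fun i a b => rev_apply_rev_of_mem_doublyStochastic (hμ.bistochastic i) a b)
  have hflip : μ.map (flipAt 0) = μ := by
    refine hμ.markov.map_relabel _ (by simp [hlam]) fun i a b => ?_
    -- Only `P 0` sees coordinate 0, and it is constant; the later transitions are not relabelled.
    rcases Nat.eq_zero_or_pos i with rfl | hi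
    · simp [hP]
    · simp [hi.ne']
  obtain ⟨f, hf, hf0, hμf, hω⟩ := exists_density hflip hμ.nonsingular hequiv
  have hII : ∀ (Y : Type u) [MeasurableSpace Y] (S : Y ≃ᵐ Y) (ν : Measure Y)
      (p : Y → (ℕ → Fin 2)), IsNaturalExtension shift μ S ν p → IsTypeIIOne S ν :=
    fun Y _ S ν p h => h.isTypeIIOne hf hf0 hμf hω ergodic_shift.quasiErgodic hμ.nonatomic
  refine ⟨⟨_, isTwoSidedMarkovMeasure_withDensity hμ.markov hlam hP hf hμf,
    isNaturalExtension_withDensity measurable_shift hf (hf0.mono fun _ h => h.1) hμf hω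
      measurePreserving_twoSidedShift measurePreserving_restrictNat (fun y => ?_)
      iSup_comap_restrictNat⟩, fun Y _ S ν p h => ⟨(hII Y S ν p h).ergodic, hII Y S ν p h⟩⟩
  funext n
  change y ((n : ℤ) + 1) = y ((n + 1 : ℕ) : ℤ)
  push_cast
  rfl
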